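/- **Setting.** Let $n\in\mathbb N$. For $v\in\mathbb R^3$ let $v^\times$ be the skew-symmetric matrix with $v^\times w=v\times w$, and for a unit vector $y$ let $\Pi_y=I_3-yy^\top$. Write $P=(R_P,x_P)\in\mathbf{SE}(3)$, identified with $\begin{pmatrix}R_P&x_P\\0&1\end{pmatrix}$, and $(\Omega,V)^\wedge=\begin{pmatrix}\Omega^\times&V\\0&0\end{pmatrix}$. A configuration is $\Xi=(P,p_1,\dots,p_n)$ with $P\in\mathbf{SE}(3)$, $p_i\in\mathbb R^3$, $p_i\ne x_P$. Its output is $h(\Xi)=(y_i,z_i)_i\in\mathcal N_n=(S^2\times\mathbb R^+)^n$ with $y_i=R_P^\top(p_i-x_P)/|p_i-x_P|$ and $z_i=|p_i-x_P|^{-1}$; $\mathcal N_n$ carries the product of the Euclidean (chordal) metrics and the product of surface and Lebesgue measure. Let $\mathbf{VSLAM}_n(3)=\mathbf{SE}(3)\times(\mathbf{SO}(3)\times\mathbf{MR})^n$, where $\mathbf{MR}$ is the multiplicative group of positive reals, and for $X=(A,(Q_i,a_i)_i)$ put $$\Upsilon(X,(P,p_i))=\bigl(PA,\ (a_i^{-1}R_{PA}Q_i^\top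 R_P^\top(p_i-x_P)+x_{PA})_i\bigr),\qquad \rho(X,(y_i,z_i)_i)=(Q_i^\top y_i,\ a_iz_i)_i .$$ For $U=(\Omega_U,V_U)$ and $\phi_i\in\mathbb R^3$ let $\lambda(\Xi,(U,\phi_i))=\bigl(U^\wedge,((\phi_i\times y_i)^\times,\ z_iy_i^\top V_U)_i\bigr)$ with $(y_i,z_i)_i=h(\Xi)$. Fix gains $k_{Q_i},k_{a_i},k_A>0$ and an origin configuration $\mathring\Xi$, with $(\mathring y_i,\mathring z_i)_i=h(\mathring\Xi)$. Consider, on $t\ge0$: * a true trajectory $\Xi(t)=(P(t),p_i)$ with $\dot P=PU^\wedge$ and static $p_i$, where the velocity $U(t)$ is continuous, the optical flow is $\phi_i=\dot y_i$, and the outputs $(y,z)=h(\Xi(t))$ are bounded (in the above metric); * a lifted trajectory $\dot X=X\,\lambda(\Upsilon(X,\mathring\Xi),(U,\phi_i))$ with $\Upsilon(X(0),\mathring\Xi)=\Xi(0)$; * an observer trajectory $\hat X=(\hat A,(\hat Q_i,\hat a_i)_i)$, with any initial value (in particular $\hat X(0)=\mathrm{id}$), $\dot{\hat X}=\hat X\,\lambda(\Upsilon(X,\mathring\Xi),(U,\phi_i))-\Delta\hat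 X$, where products are componentwise. Let $e=(e_{y_i},e_{z_i})_i=\rho(\hat X^{-1},(y,z))$, $\hat\Xi=(\hat P,\hat p_i)=\Upsilon(\hat X,\mathring\Xi)$ and $(\hat y_i,\hat z_i)_i=h(\hat\Xi)$. The innovation is $\Delta=(\Delta_A,(\Delta_Q^i,\Delta_a^i)_i)$ with $$\Delta_Q^i=-k_{Q_i}(e_{y_i}\times\mathring y_i)^\times,\qquad \Delta_a^i=-k_{a_i}\frac{e_{z_i}-\mathring z_i}{e_{z_i}},\qquad \Delta_A=-k_A\,\hat A\,(\Omega_\Delta,V_\Delta)^\wedge\hat A^{-1},$$ $$\begin{pmatrix}\Omega_\Delta\\V_\Delta\end{pmatrix}=\Bigl(\sum_{i=1}^n\begin{pmatrix}\Pi_{\hat y_i}&\hat z_i\hat y_i^\times\\-\hat z_i\hat y_i^\times&\hat z_i^2\Pi_{\hat y_i}\end{pmatrix}\Bigr)^{-1}\sum_{i=1}^n\begin{pmatrix}-\hat y_i^\times\phi_i\\-\hat z_i\phi_i\end{pmatrix}-\begin{pmatrix}\Omega_U\\V_U\end{pmatrix},$$ and the matrix that is inverted is assumed to be invertible for all $t\ge0$.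 **Theorem.** There are an open set $B\subseteq\mathcal N_n$ whose complement has measure zero, and constants $\delta,C,\alpha>0$, all depending only on $n$, the gains and $\mathring\Xi$, such that: 1. The equilibrium $h(\mathring\Xi)$ of the output error is stable, uniformly over all such trajectories: for every $\varepsilon>0$ there is $\eta>0$ such that $d(e(0),h(\mathring\Xi))<\eta$ implies $d(e(t),h(\mathring\Xi))<\varepsilon$ for all $t\ge0$. 2. For all such trajectories and all $t\ge 0$, $\Xi(t)=\Upsilon(X(t),\mathring\Xi)$ and $e=\rho(E^{-1},h(\mathring\Xi))$ with $E=\hat XX^{-1}$. 3. For all such trajectories there is a time-varying gauge transformation $S(t)\in\mathbf{SE}(3)$ with $S(t)\hat P(t)=P(t)$ for all $t\ge 0$ such that the following hold, where $S(t)(p)=R_{S(t)}p+x_{S(t)}$. * (Almost global convergence.) If $e(0)\in B$, then as $t\to\infty$: $e(t)\to h(\mathring\Xi)$; $d(h(\hat\Xi(t)),h(\Xi(t)))\to0$; $|S(t)(\hat p_i(t))-p_i|/|p_i-x_P(t)|\to0$ for all $i$; and, if the distances $|p_i-x_P(t)|$ are bounded, $|S(t)(\hat p_i(t))-p_i|\to0$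 for all $i$. * (Local exponential convergence.) If $d_0:=d(e(0),h(\mathring\Xi))<\delta$, then for all $t\ge0$ and all $i$: $d(e(t),h(\mathring\Xi))\le Ce^{-\alpha t}d_0$, $|\hat y_i-y_i|\le Ce^{-\alpha t}d_0$, $|\hat z_i-z_i|\le Ce^{-\alpha t}d_0\,z_i$, and $|S(t)(\hat p_i(t))-p_i|\le Ce^{-\alpha t}d_0\,|p_i-x_P(t)|$. -/

import Mathlib

open scoped Matrix

noncomputable section

namespace VSLAM

/-! ### Rotations, rigid-body transformations, positive reals -/

/-- Euclidean 3-space. -/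
abbrev E3 := EuclideanSpace ℝ (Fin 3)

/-- The unit sphere `S²` in Euclidean 3-space. -/
abbrev S2 := Metric.sphere (0 : E3) 1

/-- The rotation group `SO(3)`; its inverse is the transpose. -/
abbrev SO3 := Matrix.specialOrthogonalGroup (Fin 3) ℝ

/-- The positive reals, with Mathlib's multiplicative group structure: the group `MR`, and also
the space in which inverse depths take their values. -/
abbrev PosReal := {a : ℝ // 0 < a}

/-- The matrix-vector product `Q v`. -/
def rot (Q : SO3) (v : E3) : E3 := WithLp.toLp 2 ((Q : Matrix (Fin 3) (Fin 3) ℝ) *ᵥ v.ofLp)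

theorem rot_one (v : E3) : rot 1 v = v := by
  simp [rot]

theorem rot_mul (Q S : SO3) (v : E3) : rot (Q * S) v = rot Q (rot S v) := by
  simp [rot, Matrix.mulVec_mulVec]

theorem rot_add (Q : SO3) (v w : E3) : rot Q (v + w) = rot Q v + rot Q w := by
  simp [rot, Matrix.mulVec_add]

theorem rot_neg (Q : SO3) (v : E3) : rot Q (-v) = -rot Q v := by
  simp [rot, Matrix.mulVec_neg]

theorem norm_rot (Q : SO3) (v : E3) : ‖rot Q v‖ = ‖v‖ := by
  have hQ : (Q : Matrix (Fin 3) (Fin 3) ℝ)ᵀ * (Q : Matrix (Fin 3) (Fin 3) ℝ) = 1 := by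
    have h := (Matrix.mem_specialOrthogonalGroup_iff.1 Q.2).1
    exact (Matrix.mem_orthogonalGroup_iff' (Fin 3) ℝ).1 h
  have h : ‖rot Q v‖ ^ 2 = ‖v‖ ^ 2 := by
    rw [← real_inner_self_eq_norm_sq, ← real_inner_self_eq_norm_sq]
    simp only [EuclideanSpace.inner_eq_star_dotProduct, rot, star_trivial]
    rw [Matrix.dotProduct_mulVec, Matrix.vecMul_mulVec, hQ, Matrix.vecMul_one]
  exact (sq_eq_sq₀ (norm_nonneg _) (norm_nonneg _)).1 h

/-- The special Euclidean group `SE(3)`: pairs `(R, x)` of a rotation and a translation. -/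
@[ext]
structure SE3 where
  /-- the rotation component -/
  R : SO3
  /-- the translation component -/
  x : E3

instance : Mul SE3 := ⟨fun P S => ⟨P.R * S.R, rot P.R S.x + P.x⟩⟩
instance : One SE3 := ⟨⟨1, 0⟩⟩
instance : Inv SE3 := ⟨fun P => ⟨P.R⁻¹, -rot P.R⁻¹ P.x⟩⟩

instance : Group SE3 :=
  Group.ofLeftAxioms
    (fun P S T => by
      refine SE3.ext (mul_assoc P.R S.R T.R) ?_
      change rot (P.R * S.R) T.x + (rot P.R S.x + P.x) = rot P.R (rot S.R T.x + S.x) + P.x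
      rw [rot_mul, rot_add, add_assoc])
    (fun P => by
      refine SE3.ext (one_mul P.R) ?_
      change rot 1 P.x + 0 = P.x
      rw [rot_one, add_zero])
    (fun P => by
      refine SE3.ext (inv_mul_cancel P.R) ?_
      change rot P.R⁻¹ P.x + -rot P.R⁻¹ P.x = 0
      exact add_neg_cancel _)

/-- The real matrices of size `4 × 4`, in block form `3 + 1`. -/
abbrev Mat4 := Matrix (Fin 3 ⊕ Unit) (Fin 3 ⊕ Unit) ℝ

/-- The homogeneous matrix of a rigid-body transformation. -/
def SE3.toMatrix (P : SE3) : Mat4 :=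
  Matrix.fromBlocks (P.R : Matrix (Fin 3) (Fin 3) ℝ) (Matrix.of fun i _ => P.x i) 0 1

theorem SE3.toMatrix_mul (P S : SE3) : (P * S).toMatrix = P.toMatrix * S.toMatrix := by
  change SE3.toMatrix ⟨P.R * S.R, rot P.R S.x + P.x⟩ = _
  simp only [SE3.toMatrix, Matrix.fromBlocks_multiply]
  congr 1 <;> ext i j <;> simp [rot, Matrix.mul_apply, Matrix.mulVec, dotProduct]

/-- The rigid-body transformation `p ↦ R p + x` of a point. -/
def SE3.act (P : SE3) (p : E3) : E3 := rot P.R p + P.x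

/-- The skew-symmetric matrix `v^×`. -/
def skew (v : E3) : Matrix (Fin 3) (Fin 3) ℝ :=
  !![0, -v 2, v 1; v 2, 0, -v 0; -v 1, v 0, 0]

/-- The cross product on Euclidean 3-space. -/
def cross (v w : E3) : E3 := WithLp.toLp 2 (crossProduct v.ofLp w.ofLp)

theorem skew_mulVec (v w : E3) : skew v *ᵥ w.ofLp = (cross v w).ofLp := by
  ext i
  fin_cases i <;> simp [skew, cross, crossProduct, Matrix.mulVec, dotProduct, Fin.sum_univ_three]
    <;> ring

/-- The projector `Π_y = I - y yᵀ`. -/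
def proj (y : E3) : Matrix (Fin 3) (Fin 3) ℝ := 1 - Matrix.vecMulVec y.ofLp y.ofLp

/-- The matrix in `se(3)` of a pair `(Ω, V)` of angular and linear velocities. -/
def wedge (U : E3 × E3) : Mat4 :=
  Matrix.fromBlocks (skew U.1) (Matrix.of fun i _ => U.2 i) 0 0

/-! ### Configurations, outputs, and the VSLAM group -/

/-- The reduced total space: a pose together with `n` points, none of them at the pose centre. -/
@[ext]
structure Config (n : ℕ) where
  /-- the robot pose `P` -/
  pose : SE3
  /-- the landmarks `p_i` -/
  pt : Fin n → E3
  pt_ne : ∀ i, pt i ≠ pose.x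

/-- The output space `N_n(3) = (S² × ℝ⁺)ⁿ`, with the product metric. -/
abbrev Output (n : ℕ) := Fin n → S2 × PosReal

/-- The product on `N_n(3)` of the surface measure of the sphere and Lebesgue measure. -/
def outputMeasure (n : ℕ) : MeasureTheory.Measure (Output n) :=
  MeasureTheory.Measure.pi fun _ =>
    ((MeasureTheory.volume : MeasureTheory.Measure E3).toSphere).prod
      ((MeasureTheory.volume : MeasureTheory.Measure ℝ).comap Subtype.val)

theorem Config.dist_pos {n : ℕ} (Ξ : Config n) (i : Fin n) : 0 < ‖Ξ.pt i - Ξ.pose.x‖ :=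
  norm_pos_iff.2 (sub_ne_zero.2 (Ξ.pt_ne i))

/-- The output map: the bearings `y_i = R_Pᵀ (p_i - x_P) / |p_i - x_P|` and the inverse depths
`z_i = |p_i - x_P|⁻¹`. -/
def h {n : ℕ} (Ξ : Config n) : Output n := fun i =>
  (⟨‖Ξ.pt i - Ξ.pose.x‖⁻¹ • rot Ξ.pose.R⁻¹ (Ξ.pt i - Ξ.pose.x), by
      rw [mem_sphere_zero_iff_norm, norm_smul, norm_inv, norm_norm, norm_rot]
      exact inv_mul_cancel₀ (Ξ.dist_pos i).ne'⟩,
    ⟨‖Ξ.pt i - Ξ.pose.x‖⁻¹, inv_pos.2 (Ξ.dist_pos i)⟩)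

/-- The group `VSLAM_n(3) = SE(3) × (SO(3) × MR)ⁿ`, with elements `(A, (Q_i, a_i)_i)`. -/
abbrev Grp (n : ℕ) := SE3 × (Fin n → SO3 × PosReal)

/-- The right action of the VSLAM group on the reduced total space:
`(P, p_i) ↦ (P A, a_i⁻¹ R_{PA} Q_iᵀ R_Pᵀ (p_i - x_P) + x_{PA})`. -/
def Upsilon {n : ℕ} (X : Grp n) (Ξ : Config n) : Config n where
  pose := Ξ.pose * X.1
  pt i := ((X.2 i).2 : ℝ)⁻¹ •
      rot (Ξ.pose * X.1).R (rot (X.2 i).1⁻¹ (rot Ξ.pose.R⁻¹ (Ξ.pt i - Ξ.pose.x)))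
    + (Ξ.pose * X.1).x
  pt_ne i := by
    intro hi
    have h0 := congrArg norm (add_eq_right.1 hi)
    rw [norm_smul, norm_rot, norm_rot, norm_rot, norm_zero] at h0
    have ha : 0 < ‖((X.2 i).2 : ℝ)⁻¹‖ := norm_pos_iff.2 (inv_ne_zero (X.2 i).2.2.ne')
    exact (mul_pos ha (Ξ.dist_pos i)).ne' h0

/-- The right action of the VSLAM group on the output space: `(y_i, z_i) ↦ (Q_iᵀ y_i, a_i z_i)`. -/
def rho {n : ℕ} (X : Grp n) (y : Output n) : Output n := fun i =>
  (⟨rot (X.2 i).1⁻¹ (y i).1, by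
      rw [mem_sphere_zero_iff_norm, norm_rot]
      exact mem_sphere_zero_iff_norm.1 (y i).1.2⟩,
    (X.2 i).2 * (y i).2)

/-- The matrix algebra in which the VSLAM group and its Lie algebra
`se(3) × (so(3) × ℝ)ⁿ` are embedded; all operations are componentwise. -/
abbrev Ambient (n : ℕ) := Mat4 × (Fin n → Matrix (Fin 3) (Fin 3) ℝ × ℝ)

/-- The embedding of the VSLAM group in the matrix algebra. -/
def toAmbient {n : ℕ} (X : Grp n) : Ambient n :=
  (X.1.toMatrix, fun i => (((X.2 i).1 : Matrix (Fin 3) (Fin 3) ℝ), ((X.2 i).2 : ℝ)))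

/-! ### Lift, innovation, observer -/

/-- The lift `λ(Ξ, (U, φ_i)) = (U, ((φ_i × y_i)^×, z_i y_iᵀ V_U)_i)` with `(y_i, z_i) = h(Ξ)`
and `U = (Ω_U, V_U)`. -/
def lift {n : ℕ} (Ξ : Config n) (U : E3 × E3) (φ : Fin n → E3) : Ambient n :=
  (wedge U, fun i =>
    (skew (cross (φ i) (h Ξ i).1), ((h Ξ i).2 : ℝ) * inner ℝ ((h Ξ i).1 : E3) U.2))

/-- The matrix of the normal equations:
`∑ i, [[Π_{ŷ_i}, ẑ_i ŷ_i^×], [-ẑ_i ŷ_i^×, ẑ_i² Π_{ŷ_i}]]` for outputs `(ŷ_i, ẑ_i)`. -/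
def normalMatrix {n : ℕ} (y : Output n) : Matrix (Fin 3 ⊕ Fin 3) (Fin 3 ⊕ Fin 3) ℝ :=
  ∑ i, Matrix.fromBlocks (proj (y i).1) (((y i).2 : ℝ) • skew (y i).1)
    (-(((y i).2 : ℝ) • skew (y i).1)) (((y i).2 : ℝ) ^ 2 • proj (y i).1)

/-- The right-hand side of the normal equations: `∑ i, (-ŷ_i^× φ_i, -ẑ_i φ_i)`. -/
def normalVector {n : ℕ} (y : Output n) (φ : Fin n → E3) : Fin 3 ⊕ Fin 3 → ℝ :=
  ∑ i, Sum.elim (-(skew (y i).1 *ᵥ (φ i).ofLp)) (-(((y i).2 : ℝ) • (φ i).ofLp))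

/-- The velocity correction `(Ω_Δ, V_Δ)`: the least-squares velocity minus `(Ω_U, V_U)`. -/
def velocityCorrection {n : ℕ} (y : Output n) (U : E3 × E3) (φ : Fin n → E3) : E3 × E3 :=
  (WithLp.toLp 2 (fun j => ((normalMatrix y)⁻¹ *ᵥ normalVector y φ) (Sum.inl j)) - U.1,
   WithLp.toLp 2 (fun j => ((normalMatrix y)⁻¹ *ᵥ normalVector y φ) (Sum.inr j)) - U.2)

/-- The innovation `Δ = (Δ_A, (Δ_Q^i, Δ_a^i)_i)` at the observer state `Xhat`, with origin `Ξ₀`,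
output error `e`, and measured velocities `U`, `φ`; here `(ŷ, ẑ) = h(Υ(Xhat, Ξ₀))`. -/
def innovation {n : ℕ} (kQ ka : Fin n → ℝ) (kA : ℝ) (Ξ₀ : Config n)
    (Xhat : Grp n) (e : Output n) (U : E3 × E3) (φ : Fin n → E3) : Ambient n :=
  (-(kA • (Xhat.1.toMatrix *
      wedge (velocityCorrection (h (Upsilon Xhat Ξ₀)) U φ) * Xhat.1⁻¹.toMatrix)),
   fun i =>
    (-(kQ i • skew (cross (e i).1 (h Ξ₀ i).1)),
     -(ka i * ((((e i).2 : ℝ) - ((h Ξ₀ i).2 : ℝ)) / ((e i).2 : ℝ)))))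

/-- A true trajectory of the robot and the landmarks on `[0, ∞)`, with the measured velocities, a
trajectory of the lifted kinematics above it, and a trajectory of the observer; `Ξ₀` is the
origin configuration and `kQ`, `ka`, `kA` are the gains. -/
structure Run (n : ℕ) (kQ ka : Fin n → ℝ) (kA : ℝ) (Ξ₀ : Config n) where
  /-- the body-fixed velocity `(Ω_U, V_U)` -/
  U : ℝ → E3 × E3
  /-- the optical flow -/
  φ : ℝ → Fin n → E3
  /-- the true configuration -/
  Ξ : ℝ → Config n
  /-- the lifted state -/
  X : ℝ → Grp n
  /-- the observer state -/
  Xhat : ℝ → Grp n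
  U_cont : ContinuousOn U (Set.Ici 0)
  /-- the pose kinematics `Ṗ = P U` -/
  pose_deriv : ∀ t, 0 ≤ t → HasDerivWithinAt (fun s => (Ξ s).pose.toMatrix)
    ((Ξ t).pose.toMatrix * wedge (U t)) (Set.Ici 0) t
  /-- the landmarks are static -/
  pt_deriv : ∀ t, 0 ≤ t → ∀ i, HasDerivWithinAt (fun s => (Ξ s).pt i) 0 (Set.Ici 0) t
  /-- the optical flow is the velocity of the bearing -/
  flow : ∀ t, 0 ≤ t → ∀ i,
    HasDerivWithinAt (fun s => ((h (Ξ s) i).1 : E3)) (φ t i) (Set.Ici 0) t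
  /-- the outputs are bounded -/
  bounded : Bornology.IsBounded ((fun t => h (Ξ t)) '' Set.Ici 0)
  X_init : Upsilon (X 0) Ξ₀ = Ξ 0
  /-- the lifted kinematics `Ẋ = X λ(Υ(X, Ξ₀), (U, φ))` -/
  X_deriv : ∀ t, 0 ≤ t → HasDerivWithinAt (fun s => toAmbient (X s))
    (toAmbient (X t) * lift (Upsilon (X t) Ξ₀) (U t) (φ t)) (Set.Ici 0) t
  /-- the matrix that is inverted in the innovation is invertible -/
  invertible : ∀ t, 0 ≤ t → IsUnit (normalMatrix (h (Upsilon (Xhat t) Ξ₀)))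
  /-- the observer kinematics: the lifted kinematics with the correction `-Δ Xhat` -/
  Xhat_deriv : ∀ t, 0 ≤ t → HasDerivWithinAt (fun s => toAmbient (Xhat s))
    (toAmbient (Xhat t) * lift (Upsilon (X t) Ξ₀) (U t) (φ t)
      - innovation kQ ka kA Ξ₀ (Xhat t) (rho (Xhat t)⁻¹ (h (Ξ t))) (U t) (φ t)
        * toAmbient (Xhat t)) (Set.Ici 0) t

namespace Run

variable {n : ℕ} {kQ ka : Fin n → ℝ} {kA : ℝ} {Ξ₀ : Config n}

/-- The output error `e = ρ(Xhat⁻¹, (y, z))`. -/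
def e (r : Run n kQ ka kA Ξ₀) (t : ℝ) : Output n := rho (r.Xhat t)⁻¹ (h (r.Ξ t))

/-- The configuration estimate `Υ(Xhat, Ξ₀)`. -/
def Ξhat (r : Run n kQ ka kA Ξ₀) (t : ℝ) : Config n := Upsilon (r.Xhat t) Ξ₀

/-- The distance from the robot to the `i`-th landmark. -/
def range (r : Run n kQ ka kA Ξ₀) (t : ℝ) (i : Fin n) : ℝ := ‖(r.Ξ t).pt i - (r.Ξ t).pose.x‖

end Run

end VSLAM

end

noncomputable section

namespace VSLAM

open Set Filter Topology

/-! ### Vector identities -/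

/-! The output error obeys an autonomous, decoupled system. In the bearing error `e_y = Q̂ y`, the
optical flow satisfies `φ ⊥ y` and `|y| = 1`, so the lift contributes `Q̂ ((φ × y) × y) = -Q̂ φ`,
which cancels the motion of `y`. What remains is `k (e_y × b) × e_y = k (b - ⟪b, e_y⟫ e_y)`, the
gradient flow on the sphere towards the reference bearing `b` (`hasDerivWithinAt_e_fst`). The depth
error is linear: `(e_z - z₀)' = -k (e_z - z₀)` (`hasDerivWithinAt_e_snd`). The pose component of the
innovation does not enter either equation.

On the sphere, `ℓ = 1 - ⟪e_y, b⟫ = |e_y - b|² / 2` satisfies `ℓ' = -k (1 + ⟪e_y, b⟫) ℓ`. The factor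
`1 + ⟪e_y, b⟫` never falls below its initial value, so decay is exponential unless `e_y` starts at
`-b` (`sphereFlow_decay`). The basin thus excludes only finitely many antipodal conditions, each of
measure zero.

To use the equations, the lift along `Υ(X, Ξ₀)` must be the lift along the true trajectory;
`Ξ_eq_Upsilon` proves this by uniqueness for the kinematics. Finally, `h Ξ̂` and `h Ξ` are the
images of `h Ξ₀` and `e` under the same group element, which gives exact formulas for the bearing
and depth errors. Aligning the poses by `P P̂⁻¹` then turns them into a bound on the landmark error.
-/

theorem inner_eq_sum (v w : E3) : inner ℝ v w = v 0 * w 0 + v 1 * w 1 + v 2 * w 2 := by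
  simp [PiLp.inner_apply, Fin.sum_univ_three, mul_comm]

theorem inner_cross_right_self (v w : E3) : inner ℝ w (cross v w) = 0 := by
  rw [inner_eq_sum]
  simp [cross, crossProduct]
  ring

theorem cross_cross_left (u v w : E3) :
    cross (cross u v) w = inner ℝ u w • v - inner ℝ v w • u := by
  ext i
  fin_cases i <;> simp [cross, crossProduct, inner_eq_sum] <;> ring

theorem toLp_skew_mulVec (v w : E3) : WithLp.toLp 2 (skew v *ᵥ w.ofLp) = cross v w := by
  rw [skew_mulVec]

theorem transpose_skew (v : E3) : (skew v)ᵀ = -skew v := by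
  ext i j
  fin_cases i <;> fin_cases j <;> simp [skew]

theorem rot_smul (Q : SO3) (c : ℝ) (v : E3) : rot Q (c • v) = c • rot Q v := by
  simp [rot, Matrix.mulVec_smul]

theorem rot_sub (Q : SO3) (v w : E3) : rot Q (v - w) = rot Q v - rot Q w := by
  simp [rot, Matrix.mulVec_sub]

theorem rot_inv_rot (Q : SO3) (v : E3) : rot Q⁻¹ (rot Q v) = v := by
  rw [← rot_mul, inv_mul_cancel, rot_one]

theorem rot_rot_inv (Q : SO3) (v : E3) : rot Q (rot Q⁻¹ v) = v := by
  rw [← rot_mul, mul_inv_cancel, rot_one]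

theorem dist_rot (Q : SO3) (v w : E3) : dist (rot Q v) (rot Q w) = dist v w := by
  rw [dist_eq_norm, dist_eq_norm, ← rot_sub, norm_rot]

theorem norm_S2 (y : S2) : ‖(y : E3)‖ = 1 := mem_sphere_zero_iff_norm.1 y.2

theorem inner_self_S2 (y : S2) : inner ℝ (y : E3) (y : E3) = 1 := by
  rw [real_inner_self_eq_norm_sq, norm_S2, one_pow]

/-! ### Derivatives of vectors and matrices by entries -/

theorem hasDerivWithinAt_E3 {v : ℝ → E3} {v' : E3} {s : Set ℝ} {t : ℝ} :
    HasDerivWithinAt v v' s t ↔ ∀ i, HasDerivWithinAt (fun u => v u i) (v' i) s t := by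
  constructor
  · intro hv i
    refine (hasFDerivWithinAt_euclidean.1 hv.hasFDerivWithinAt i).hasDerivWithinAt.congr_deriv ?_
    simp
  · intro hv
    rw [hasDerivWithinAt_iff_hasFDerivWithinAt, hasFDerivWithinAt_euclidean]
    intro i
    have h1 := (hv i).hasFDerivWithinAt
    refine h1.congr_fderiv ?_
    ext
    simp

theorem hasDerivWithinAt_pose_entry {M : ℝ → Mat4} {M' : Mat4}
    {s : Set ℝ} {t : ℝ} (hM : HasDerivWithinAt M M' s t) (i j) :
    HasDerivWithinAt (fun u => M u i j) (M' i j) s t := by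
  have h1 : HasDerivWithinAt (F := Fin 3 ⊕ Unit → Fin 3 ⊕ Unit → ℝ) M M' s t := hM
  exact hasDerivWithinAt_pi.1 (hasDerivWithinAt_pi.1 h1 i) j

theorem hasDerivWithinAt_prod_pi_prod {E F G ι : Type*} [Fintype ι]
    [NormedAddCommGroup E] [NormedSpace ℝ E] [NormedAddCommGroup F] [NormedSpace ℝ F]
    [NormedAddCommGroup G] [NormedSpace ℝ G] {M : ℝ → E × (ι → F × G)} {M' : E × (ι → F × G)}
    {s : Set ℝ} {t : ℝ} (hM : HasDerivWithinAt M M' s t) :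
    HasDerivWithinAt (fun u => (M u).1) M'.1 s t ∧
      ∀ k, HasDerivWithinAt (fun u => ((M u).2 k).1) (M'.2 k).1 s t ∧
        HasDerivWithinAt (fun u => ((M u).2 k).2) (M'.2 k).2 s t := by
  refine ⟨hM.hasFDerivWithinAt.fst.hasDerivWithinAt.congr_deriv (by simp), fun k => ?_⟩
  have h2 := hasDerivWithinAt_pi.1 hM.hasFDerivWithinAt.snd.hasDerivWithinAt k
  exact ⟨h2.hasFDerivWithinAt.fst.hasDerivWithinAt.congr_deriv (by simp),
    h2.hasFDerivWithinAt.snd.hasDerivWithinAt.congr_deriv (by simp)⟩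

section MatrixNorm

attribute [local instance] Matrix.normedAddCommGroup Matrix.normedSpace

/-- The entrywise norm on matrices induces the product topology, so it supplies the normed structure
required by the general lemma without changing the notion of derivative. -/
theorem hasDerivWithinAt_ambient {n : ℕ} {M : ℝ → Ambient n} {M' : Ambient n}
    {s : Set ℝ} {t : ℝ} (hM : HasDerivWithinAt M M' s t) :
    HasDerivWithinAt (fun u => (M u).1) M'.1 s t ∧
      ∀ k, HasDerivWithinAt (fun u => ((M u).2 k).1) (M'.2 k).1 s t ∧
        HasDerivWithinAt (fun u => ((M u).2 k).2) (M'.2 k).2 s t :=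
  hasDerivWithinAt_prod_pi_prod hM

end MatrixNorm

theorem hasDerivWithinAt_matrix_entry {M : ℝ → Matrix (Fin 3) (Fin 3) ℝ}
    {M' : Matrix (Fin 3) (Fin 3) ℝ}
    {s : Set ℝ} {t : ℝ} (hM : HasDerivWithinAt M M' s t) (i j) :
    HasDerivWithinAt (fun u => M u i j) (M' i j) s t := by
  have h1 : HasDerivWithinAt (F := Fin 3 → Fin 3 → ℝ) M M' s t := hM
  exact hasDerivWithinAt_pi.1 (hasDerivWithinAt_pi.1 h1 i) j

theorem hasDerivWithinAt_rot {Q : ℝ → SO3} {M : Matrix (Fin 3) (Fin 3) ℝ} {v : ℝ → E3} {v' : E3}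
    {s : Set ℝ} {t : ℝ}
    (hQ : ∀ i j, HasDerivWithinAt (fun u => (Q u : Matrix (Fin 3) (Fin 3) ℝ) i j) (M i j) s t)
    (hv : HasDerivWithinAt v v' s t) :
    HasDerivWithinAt (fun u => rot (Q u) (v u))
      (WithLp.toLp 2 (M *ᵥ (v t).ofLp) + rot (Q t) v') s t := by
  rw [hasDerivWithinAt_E3] at hv ⊢
  intro i
  have h1 := HasDerivWithinAt.fun_sum (u := Finset.univ) fun j _ => (hQ i j).mul (hv j)
  refine HasDerivWithinAt.congr_deriv (f := fun u => (rot (Q u) (v u)) i) h1 ?_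
  simp [rot, Matrix.mulVec, dotProduct, Finset.sum_add_distrib]

/-- Derivative in the body frame of a rotation with angular velocity `ω`. -/
theorem hasDerivWithinAt_rot_inv {Q : ℝ → SO3} {ω : E3} {v : ℝ → E3} {v' : E3}
    {s : Set ℝ} {t : ℝ}
    (hQ : ∀ i j, HasDerivWithinAt (fun u => (Q u : Matrix (Fin 3) (Fin 3) ℝ) i j)
      (((Q t : Matrix (Fin 3) (Fin 3) ℝ) * skew ω) i j) s t)
    (hv : HasDerivWithinAt v v' s t) :
    HasDerivWithinAt (fun u => rot (Q u)⁻¹ (v u))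
      (-cross ω (rot (Q t)⁻¹ (v t)) + rot (Q t)⁻¹ v') s t := by
  -- The inverse in `SO3` is the transpose, hence the swapped indices; `(Q ω^×)ᵀ = -ω^× Qᵀ` gives
  -- the sign.
  have h1 := hasDerivWithinAt_rot (Q := fun u => (Q u)⁻¹)
    (M := ((Q t : Matrix (Fin 3) (Fin 3) ℝ) * skew ω)ᵀ) (fun i j => hQ j i) hv
  convert h1 using 2
  rw [Matrix.transpose_mul, transpose_skew, ← Matrix.mulVec_mulVec, Matrix.neg_mulVec,
    ← toLp_skew_mulVec]
  rfl

theorem SE3.hasDerivWithinAt_R {P : ℝ → SE3} {U : E3 × E3} {s : Set ℝ} {t : ℝ}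
    (hP : HasDerivWithinAt (fun u => (P u).toMatrix) ((P t).toMatrix * wedge U) s t) (i j) :
    HasDerivWithinAt (fun u => ((P u).R : Matrix (Fin 3) (Fin 3) ℝ) i j)
      ((((P t).R : Matrix (Fin 3) (Fin 3) ℝ) * skew U.1) i j) s t := by
  have h1 := hasDerivWithinAt_pose_entry hP (Sum.inl i) (Sum.inl j)
  simpa [SE3.toMatrix, wedge, Matrix.fromBlocks_multiply] using h1

theorem SE3.hasDerivWithinAt_x {P : ℝ → SE3} {U : E3 × E3} {s : Set ℝ} {t : ℝ}
    (hP : HasDerivWithinAt (fun u => (P u).toMatrix) ((P t).toMatrix * wedge U) s t) :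
    HasDerivWithinAt (fun u => (P u).x) (rot (P t).R U.2) s t := by
  rw [hasDerivWithinAt_E3]
  intro i
  have h1 := hasDerivWithinAt_pose_entry hP (Sum.inl i) (Sum.inr ())
  simpa [SE3.toMatrix, wedge, Matrix.fromBlocks_multiply, rot, Matrix.mul_apply, Matrix.mulVec,
    dotProduct] using h1

/-! ### Scalar and vector differential inequalities on the half line -/

theorem eq_of_hasDerivWithinAt_zero {F : Type*} [NormedAddCommGroup F] [NormedSpace ℝ F]
    {f : ℝ → F} (hf : ∀ t, 0 ≤ t → HasDerivWithinAt f 0 (Ici 0) t) {t : ℝ} (ht : 0 ≤ t) :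
    f t = f 0 := by
  have h1 := Convex.norm_image_sub_le_of_norm_hasDerivWithin_le (f := f) (f' := fun _ => 0)
    (s := Ici (0 : ℝ)) (C := 0) (x := 0) (y := t) (fun x hx => hf x hx) (by simp)
    (convex_Ici 0) (by simp) ht
  rw [zero_mul] at h1
  exact sub_eq_zero.1 (norm_le_zero_iff.1 h1)

/-- On the compact interval `[0, t]` the coefficient `b` is bounded by a constant `K`, and Grönwall
with zero initial value applies. -/
theorem eq_zero_of_norm_deriv_le {F : Type*} [NormedAddCommGroup F] [NormedSpace ℝ F]
    {f f' : ℝ → F} {b : ℝ → ℝ} (hf : ∀ t, 0 ≤ t → HasDerivWithinAt f (f' t) (Ici 0) t)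
    (hb : ContinuousOn b (Ici 0)) (hf' : ∀ t, 0 ≤ t → ‖f' t‖ ≤ b t * ‖f t‖) (h0 : f 0 = 0)
    {t : ℝ} (ht : 0 ≤ t) : f t = 0 := by
  obtain ⟨K, hK⟩ := isCompact_Icc.bddAbove_image 
    (hb.mono (Icc_subset_Ici_self : Icc 0 t ⊆ Ici 0))
  have h1 := norm_le_gronwallBound_of_norm_deriv_right_le (f := f) (f' := f') (δ := 0) (K := K)
    (ε := 0) (a := 0) (b := t)
    (fun u hu => ((hf u hu.1).continuousWithinAt).mono Icc_subset_Ici_self)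
    (fun u hu => (hf u hu.1).mono (Ici_subset_Ici.2 hu.1)) (by simp [h0])
    (fun u hu => by
      rw [add_zero]
      exact (hf' u hu.1).trans (mul_le_mul_of_nonneg_right
        (hK (mem_image_of_mem _ (Ico_subset_Icc_self hu))) (norm_nonneg _)))
    t ⟨ht, le_rfl⟩
  rw [gronwallBound_ε0_δ0] at h1
  exact norm_le_zero_iff.1 h1

/-- The product `exp (k u) * f u` is nonincreasing. No sign is imposed on `k` or `f`; the case `k =
0` is monotonicity. -/
theorem le_exp_mul_of_deriv_le {f f' : ℝ → ℝ} {k : ℝ}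
    (hf : ∀ t, 0 ≤ t → HasDerivWithinAt f (f' t) (Ici 0) t)
    (hf' : ∀ t, 0 ≤ t → f' t ≤ -k * f t) {t : ℝ} (ht : 0 ≤ t) :
    f t ≤ Real.exp (-k * t) * f 0 := by
  have hE : ∀ u : ℝ, HasDerivAt (fun u => Real.exp (k * u)) (Real.exp (k * u) * k) u := by
    intro u
    simpa using ((hasDerivAt_id u).const_mul k).exp
  have hF : ∀ u, 0 ≤ u → HasDerivWithinAt (fun u => Real.exp (k * u) * f u)
      (Real.exp (k * u) * k * f u + Real.exp (k * u) * f' u) (Ici 0) u :=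
    fun u hu => (hE u).hasDerivWithinAt.mul (hf u hu)
  have hA : AntitoneOn (fun u => Real.exp (k * u) * f u) (Ici 0) := by
    have hd : ∀ u ∈ interior (Ici (0 : ℝ)), HasDerivAt (fun u => Real.exp (k * u) * f u)
        (Real.exp (k * u) * k * f u + Real.exp (k * u) * f' u) u := by
      intro u hu
      rw [interior_Ici] at hu
      exact (hF u (le_of_lt hu)).hasDerivAt (Ici_mem_nhds hu)
    refine antitoneOn_of_deriv_nonpos (convex_Ici 0)
      (fun u hu => (hF u hu).continuousWithinAt)
      (fun u hu => (hd u hu).differentiableAt.differentiableWithinAt) fun u hu => ?_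
    rw [(hd u hu).deriv]
    have h1 := hf' u (interior_subset hu)
    have h2 := mul_le_mul_of_nonneg_left h1 (Real.exp_pos (k * u)).le
    linarith
  have h1 := hA (self_mem_Ici) (mem_Ici.2 ht) ht
  simp only [mul_zero, Real.exp_zero, one_mul] at h1
  have h2 := mul_le_mul_of_nonneg_left h1 (Real.exp_pos (-k * t)).le
  rwa [← mul_assoc, ← Real.exp_add, show -k * t + k * t = 0 by ring, Real.exp_zero,
    one_mul] at h2

theorem abs_le_exp_mul_of_deriv_eq {f : ℝ → ℝ} {k : ℝ}
    (hf : ∀ t, 0 ≤ t → HasDerivWithinAt f (-k * f t) (Ici 0) t) {t : ℝ} (ht : 0 ≤ t) :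
    |f t| ≤ Real.exp (-k * t) * |f 0| := by
  have h1 := le_exp_mul_of_deriv_le hf (fun _ _ => le_rfl) ht
  have h2 := le_exp_mul_of_deriv_le (f := fun u => -f u) (k := k) (fun u hu => (hf u hu).neg)
    (fun u _ => by linarith) ht
  have h3 := (Real.exp_pos (-k * t)).le
  rw [abs_le]
  constructor
  · nlinarith [le_abs_self (f 0), neg_abs_le (f 0)]
  · nlinarith [le_abs_self (f 0), neg_abs_le (f 0)]

/-! ### The bearing error flow on the sphere -/

section SphereFlow

variable {v : ℝ → S2} {b : S2} {k : ℝ}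

theorem norm_sub_sq_S2 (y b : S2) :
    ‖(y : E3) - b‖ ^ 2 = 2 * (1 - inner ℝ (y : E3) b) := by
  rw [norm_sub_sq_real, norm_S2, norm_S2]
  ring

theorem abs_inner_S2_le_one (y b : S2) : |inner ℝ (y : E3) (b : E3)| ≤ 1 := by
  have h1 := abs_real_inner_le_norm (y : E3) (b : E3)
  rwa [norm_S2, norm_S2, one_mul] at h1

theorem neg_one_lt_inner_S2 {y b : S2} (hy : (y : E3) ≠ -b) : -1 < inner ℝ (y : E3) (b : E3) := by
  refine lt_of_le_of_ne (abs_le.1 (abs_inner_S2_le_one y b)).1 fun hc => hy ?_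
  rw [← add_eq_zero_iff_eq_neg, ← norm_eq_zero, ← sq_eq_zero_iff, norm_add_sq_real, norm_S2,
    norm_S2, ← hc]
  norm_num

/-- By the triple product identity the field is `k (b - ⟪b, v⟫ v)`, so `⟪v, b⟫' = k (1 - ⟪v, b⟫²)`,
which factors. -/
theorem hasDerivWithinAt_inner_sphereFlow {t : ℝ} {s : Set ℝ}
    (hv : HasDerivWithinAt (fun u => (v u : E3))
      (k • cross (cross (v t) b) (v t)) s t) :
    HasDerivWithinAt (fun u => 1 - inner ℝ (v u : E3) (b : E3))
      (-(k * (1 + inner ℝ (v t : E3) (b : E3))) * (1 - inner ℝ (v t : E3) (b : E3))) s t := by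
  have h1 := (hv.inner ℝ (hasDerivWithinAt_const t s (b : E3))).const_sub 1
  refine h1.congr_deriv ?_
  rw [cross_cross_left, inner_self_S2, inner_zero_right, inner_smul_left, inner_sub_left,
    inner_smul_left, inner_smul_left, real_inner_comm (v t : E3) (b : E3), inner_self_S2]
  simp only [conj_trivial]
  ring

/-- A bootstrap: the case `k = 0` of the exponential comparison shows that `1 - ⟪v, b⟫` does not
increase. Hence `1 + ⟪v, b⟫` stays above its initial value, and the comparison is applied again with
that rate. -/
theorem sphereFlow_decay (hk : 0 ≤ k)
    (hv : ∀ t, 0 ≤ t → HasDerivWithinAt (fun u => (v u : E3))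
      (k • cross (cross (v t) b) (v t)) (Ici 0) t) {t : ℝ} (ht : 0 ≤ t) :
    ‖(v t : E3) - b‖ ^ 2 ≤
      Real.exp (-(k * (1 + inner ℝ (v 0 : E3) (b : E3))) * t) * ‖(v 0 : E3) - b‖ ^ 2 := by
  have hd := fun t ht => hasDerivWithinAt_inner_sphereFlow (hv t ht)
  have hnn : ∀ t, 0 ≤ 1 - inner ℝ (v t : E3) (b : E3) := fun t =>
    sub_nonneg.2 (abs_le.1 (abs_inner_S2_le_one _ _)).2
  have hpp : ∀ t, 0 ≤ 1 + inner ℝ (v t : E3) (b : E3) := fun t => by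
    linarith [(abs_le.1 (abs_inner_S2_le_one (v t) b)).1]
  have hmono : ∀ t, 0 ≤ t → 1 - inner ℝ (v t : E3) (b : E3) ≤ 1 - inner ℝ (v 0 : E3) (b : E3) := by
    intro t ht
    have h1 := le_exp_mul_of_deriv_le (k := 0) hd (fun u _ => by
      have := mul_nonneg (mul_nonneg hk (hpp u)) (hnn u)
      linarith) ht
    simpa using h1
  have h1 := le_exp_mul_of_deriv_le (k := k * (1 + inner ℝ (v 0 : E3) (b : E3))) hd (fun u hu => by
      refine mul_le_mul_of_nonneg_right (neg_le_neg (mul_le_mul_of_nonneg_left ?_ hk)) (hnn u)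
      linarith [hmono u hu]) ht
  rw [norm_sub_sq_S2, norm_sub_sq_S2]
  linarith

theorem sphereFlow_norm_le (hk : 0 ≤ k)
    (hv : ∀ t, 0 ≤ t → HasDerivWithinAt (fun u => (v u : E3))
      (k • cross (cross (v t) b) (v t)) (Ici 0) t) {t : ℝ} (ht : 0 ≤ t) :
    ‖(v t : E3) - b‖ ≤
      Real.exp (-(k * (1 + inner ℝ (v 0 : E3) (b : E3)) / 2) * t) * ‖(v 0 : E3) - b‖ := by
  have h1 := sphereFlow_decay hk hv ht
  refine le_of_sq_le_sq ?_ (by positivity)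
  rw [mul_pow, ← Real.exp_nat_mul]
  refine h1.trans_eq ?_
  congr 2
  push_cast
  ring

end SphereFlow

/-! ### Geometry of the actions -/

theorem SE3.mul_R (P S : SE3) : (P * S).R = P.R * S.R := rfl

theorem SE3.mul_x (P S : SE3) : (P * S).x = rot P.R S.x + P.x := rfl

theorem SE3.act_mul (P S : SE3) (p : E3) : (P * S).act p = P.act (S.act p) := by
  simp only [SE3.act, SE3.mul_R, SE3.mul_x, rot_mul, rot_add, add_assoc]

theorem rot_injective {Q S : SO3} (hQS : ∀ v, rot Q v = rot S v) : Q = S := by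
  apply Subtype.ext
  ext i j
  have h1 := congrArg (fun w : E3 => w i) (hQS (EuclideanSpace.single j 1))
  simpa [rot] using h1

theorem norm_Upsilon_sub {n : ℕ} (X : Grp n) (Ξ : Config n) (i : Fin n) :
    ‖(Upsilon X Ξ).pt i - (Upsilon X Ξ).pose.x‖ =
      ((X.2 i).2 : ℝ)⁻¹ * ‖Ξ.pt i - Ξ.pose.x‖ := by
  simp only [Upsilon, add_sub_cancel_right]
  rw [norm_smul, norm_rot, norm_rot, norm_rot, norm_inv, Real.norm_of_nonneg (X.2 i).2.2.le]

theorem h_Upsilon {n : ℕ} (X : Grp n) (Ξ : Config n) : h (Upsilon X Ξ) = rho X (h Ξ) := by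
  have ha : ∀ i, ((X.2 i).2 : ℝ) ≠ 0 := fun i => (X.2 i).2.2.ne'
  funext i
  refine Prod.ext (Subtype.ext ?_) (Subtype.ext ?_)
  · change ‖(Upsilon X Ξ).pt i - (Upsilon X Ξ).pose.x‖⁻¹ •
      rot (Upsilon X Ξ).pose.R⁻¹ ((Upsilon X Ξ).pt i - (Upsilon X Ξ).pose.x) =
      rot (X.2 i).1⁻¹ (‖Ξ.pt i - Ξ.pose.x‖⁻¹ • rot Ξ.pose.R⁻¹ (Ξ.pt i - Ξ.pose.x))
    rw [norm_Upsilon_sub]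
    simp only [Upsilon, add_sub_cancel_right]
    rw [rot_smul, rot_inv_rot, rot_smul, smul_smul, mul_inv, inv_inv, mul_right_comm,
      mul_inv_cancel₀ (ha i), one_mul]
  · change ‖(Upsilon X Ξ).pt i - (Upsilon X Ξ).pose.x‖⁻¹ =
      ((X.2 i).2 : ℝ) * ‖Ξ.pt i - Ξ.pose.x‖⁻¹
    rw [norm_Upsilon_sub, mul_inv, inv_inv]

theorem rho_mul {n : ℕ} (X Y : Grp n) (y : Output n) : rho (X * Y) y = rho Y (rho X y) := by
  funext i
  refine Prod.ext (Subtype.ext ?_) ?_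
  · simp [rho, rot_mul]
  · simp [rho, mul_assoc, mul_left_comm]

theorem h_snd_inv {n : ℕ} (Ξ : Config n) (i : Fin n) :
    ((h Ξ i).2 : ℝ)⁻¹ = ‖Ξ.pt i - Ξ.pose.x‖ := inv_inv _

theorem pose_act_h {n : ℕ} (Ξ : Config n) (i : Fin n) :
    Ξ.pose.act (((h Ξ i).2 : ℝ)⁻¹ • ((h Ξ i).1 : E3)) = Ξ.pt i := by
  rw [h_snd_inv]
  change rot Ξ.pose.R (_ • (_ • rot Ξ.pose.R⁻¹ _)) + Ξ.pose.x = _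
  rw [smul_smul, mul_inv_cancel₀ (Ξ.dist_pos i).ne', one_smul, rot_rot_inv, sub_add_cancel]

theorem Config.eq_of_pose_of_h {n : ℕ} {Ξ Ξ' : Config n} (hP : Ξ.pose = Ξ'.pose)
    (hh : h Ξ = h Ξ') : Ξ = Ξ' := by
  refine Config.ext hP (funext fun i => ?_)
  rw [← pose_act_h Ξ, ← pose_act_h Ξ', hP, hh]

/-- The quotient of two solutions of the same left-invariant equation is constant. For rotations
this is `R_P R_Aᵀ w`, evaluated at the fixed vector `w = R_A(t) w₀`; for translations it is `x_P -
R_{P₀} x_A`. -/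
theorem SE3.eq_mul_of_kinematics {P A : ℝ → SE3} {U : ℝ → E3 × E3} {P₀ : SE3}
    (hP : ∀ t, 0 ≤ t → HasDerivWithinAt (fun u => (P u).toMatrix)
      ((P t).toMatrix * wedge (U t)) (Ici 0) t)
    (hA : ∀ t, 0 ≤ t → HasDerivWithinAt (fun u => (A u).toMatrix)
      ((A t).toMatrix * wedge (U t)) (Ici 0) t)
    (h0 : P 0 = P₀ * A 0) {t : ℝ} (ht : 0 ≤ t) : P t = P₀ * A t := by
  have hrot : ∀ w : E3, ∀ t, 0 ≤ t → rot (P t).R w = rot P₀.R (rot (A t).R w) := by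
    intro w t ht
    have hc : ∀ u, 0 ≤ u → HasDerivWithinAt
        (fun u => rot (P u).R (rot (A u).R⁻¹ (rot (A t).R w))) 0 (Ici 0) u := by
      intro u hu
      have h1 := hasDerivWithinAt_rot_inv (SE3.hasDerivWithinAt_R (hA u hu))
        (hasDerivWithinAt_const u (Ici 0) (rot (A t).R w))
      have h2 := hasDerivWithinAt_rot (SE3.hasDerivWithinAt_R (hP u hu)) h1
      refine h2.congr_deriv ?_
      rw [← Matrix.mulVec_mulVec, skew_mulVec]
      change rot (P u).R _ + _ = _
      rw [← rot_add]
      simp [rot]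
    have h1 := eq_of_hasDerivWithinAt_zero hc ht
    simp only [h0, SE3.mul_R, rot_inv_rot, rot_mul, rot_rot_inv] at h1
    exact h1
  have hR : (P t).R = (P₀ * A t).R := rot_injective fun w => by
    rw [hrot w t ht, SE3.mul_R, rot_mul]
  refine SE3.ext hR ?_
  have hc : ∀ u, 0 ≤ u → HasDerivWithinAt
      (fun u => (P u).x - rot P₀.R (A u).x) 0 (Ici 0) u := by
    intro u hu
    have h1 := hasDerivWithinAt_rot (Q := fun _ => P₀.R) (M := 0)
      (fun i j => hasDerivWithinAt_const u (Ici 0) _) (SE3.hasDerivWithinAt_x (hA u hu))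
    refine ((SE3.hasDerivWithinAt_x (hP u hu)).sub h1).congr_deriv ?_
    rw [hrot _ u hu]
    simp
  have h1 := eq_of_hasDerivWithinAt_zero hc ht
  simp only [h0, SE3.mul_x, add_sub_cancel_left] at h1
  rw [SE3.mul_x, ← h1, add_sub_cancel]

namespace Run

variable {n : ℕ} {kQ ka : Fin n → ℝ} {kA : ℝ} {Ξ₀ : Config n} (r : Run n kQ ka kA Ξ₀)

/-! ### Kinematics of the true outputs -/

theorem h_snd_eq (t : ℝ) (i : Fin n) : ((h (r.Ξ t) i).2 : ℝ) = (r.range t i)⁻¹ := rfl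

theorem range_pos (t : ℝ) (i : Fin n) : 0 < r.range t i := (r.Ξ t).dist_pos i

/-- The position of a landmark in the body frame. -/
def bodyPt (t : ℝ) (i : Fin n) : E3 := rot (r.Ξ t).pose.R⁻¹ ((r.Ξ t).pt i - (r.Ξ t).pose.x)

theorem norm_bodyPt (t : ℝ) (i : Fin n) : ‖r.bodyPt t i‖ = r.range t i := norm_rot _ _

theorem h_fst_eq (t : ℝ) (i : Fin n) :
    ((h (r.Ξ t) i).1 : E3) = (r.range t i)⁻¹ • r.bodyPt t i := rfl

theorem bodyPt_eq (t : ℝ) (i : Fin n) : r.bodyPt t i = r.range t i • ((h (r.Ξ t) i).1 : E3) := by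
  rw [h_fst_eq, smul_smul, mul_inv_cancel₀ (r.range_pos t i).ne', one_smul]

theorem hasDerivWithinAt_bodyPt {t : ℝ} (ht : 0 ≤ t) (i : Fin n) :
    HasDerivWithinAt (fun u => r.bodyPt u i)
      (-cross (r.U t).1 (r.bodyPt t i) - (r.U t).2) (Ici 0) t := by
  refine (hasDerivWithinAt_rot_inv (SE3.hasDerivWithinAt_R (r.pose_deriv t ht))
    ((r.pt_deriv t ht i).sub (SE3.hasDerivWithinAt_x (r.pose_deriv t ht)))).congr_deriv ?_
  rw [zero_sub, rot_neg, rot_inv_rot, ← sub_eq_add_neg]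
  rfl

/-- The range is the norm of the body-frame position, and `Ω × q` is orthogonal to `q`, so only the
linear velocity contributes. -/
theorem hasDerivWithinAt_range {t : ℝ} (ht : 0 ≤ t) (i : Fin n) :
    HasDerivWithinAt (fun u => r.range u i)
      (-inner ℝ ((h (r.Ξ t) i).1 : E3) (r.U t).2) (Ici 0) t := by
  have h1 := (r.hasDerivWithinAt_bodyPt ht i).norm_sq.sqrt
    (pow_ne_zero 2 (by rw [norm_bodyPt]; exact (r.range_pos t i).ne'))
  simp only [norm_bodyPt, Real.sqrt_sq (r.range_pos _ i).le] at h1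
  refine h1.congr_deriv ?_
  have hr := (r.range_pos t i).ne'
  rw [inner_sub_right, inner_neg_right, inner_cross_right_self, bodyPt_eq, inner_smul_left]
  simp only [conj_trivial]
  field_simp
  ring

theorem uniqueDiff {t : ℝ} (ht : 0 ≤ t) : UniqueDiffWithinAt ℝ (Ici (0 : ℝ)) t :=
  uniqueDiffOn_Ici 0 t ht

theorem inner_flow {t : ℝ} (ht : 0 ≤ t) (i : Fin n) :
    inner ℝ ((h (r.Ξ t) i).1 : E3) (r.φ t i) = 0 := by
  have h1 := (r.flow t ht i).norm_sq
  simp only [norm_S2, one_pow] at h1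
  have h2 := (uniqueDiff ht).eq_deriv _ h1 (hasDerivWithinAt_const t _ 1)
  linarith

/-- Product rule for `y = q / r` together with uniqueness of derivatives. The explicit formula is
what makes the flow continuous in time, as Grönwall needs below. -/
theorem flow_eq {t : ℝ} (ht : 0 ≤ t) (i : Fin n) :
    r.φ t i = (r.range t i)⁻¹ • (-cross (r.U t).1 (r.bodyPt t i) - (r.U t).2) +
      (inner ℝ ((h (r.Ξ t) i).1 : E3) (r.U t).2 / (r.range t i) ^ 2) • r.bodyPt t i := by
  have h1 := ((r.hasDerivWithinAt_range ht i).fun_inv (r.range_pos t i).ne').smul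
    (r.hasDerivWithinAt_bodyPt ht i)
  have h2 := (uniqueDiff ht).eq_deriv _ (r.flow t ht i) h1
  rw [h2, neg_neg]

theorem continuousOn_flow (i : Fin n) : ContinuousOn (fun t => r.φ t i) (Ici 0) := by
  have hq : ContinuousOn (fun t => r.bodyPt t i) (Ici 0) :=
    fun t ht => (r.hasDerivWithinAt_bodyPt ht i).continuousWithinAt
  have hr : ContinuousOn (fun t => r.range t i) (Ici 0) :=
    fun t ht => (r.hasDerivWithinAt_range ht i).continuousWithinAt
  have hy : ContinuousOn (fun t => ((h (r.Ξ t) i).1 : E3)) (Ici 0) :=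
    fun t ht => (r.flow t ht i).continuousWithinAt
  have hU := r.U_cont
  have hc : Continuous fun p : E3 × E3 => cross p.1 p.2 := by
    simp only [cross, cross_apply]
    fun_prop
  have hcr : ContinuousOn (fun t => cross (r.U t).1 (r.bodyPt t i)) (Ici 0) :=
    hc.comp_continuousOn (hU.fst.prodMk hq)
  have hne : ∀ t ∈ Ici (0 : ℝ), r.range t i ≠ 0 := fun t _ => (r.range_pos t i).ne'
  refine ContinuousOn.congr ?_ fun t ht => r.flow_eq ht i
  exact ((hr.inv₀ hne).smul (hcr.neg.sub hU.snd)).add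
    (((hy.inner hU.snd).div (hr.pow 2) fun t ht => pow_ne_zero 2 (hne t ht)).smul hq)

/-! ### The lifted trajectory -/

theorem pose_X {t : ℝ} (ht : 0 ≤ t) : (r.Ξ t).pose = Ξ₀.pose * (r.X t).1 := by
  refine SE3.eq_mul_of_kinematics (P := fun t => (r.Ξ t).pose) (A := fun t => (r.X t).1)
    r.pose_deriv (fun u hu => (hasDerivWithinAt_ambient (r.X_deriv u hu)).1) ?_ ht
  simp only [← r.X_init]
  rfl

/-- The lifted bearing `ỹ` satisfies `ỹ' = φ - ⟪φ, ỹ⟫ ỹ`, while `y' = φ` with `⟪φ, y⟫ = 0`. Their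
difference `w` therefore has derivative `-⟪φ, w⟫ ỹ`, of norm at most `|φ| |w|`, and vanishes at time
`0`. -/
theorem h_fst_X {t : ℝ} (ht : 0 ≤ t) (i : Fin n) :
    (h (Upsilon (r.X t) Ξ₀) i).1 = (h (r.Ξ t) i).1 := by
  have hw : ∀ u, 0 ≤ u → HasDerivWithinAt
      (fun u => ((h (Upsilon (r.X u) Ξ₀) i).1 : E3) - ((h (r.Ξ u) i).1 : E3))
      (-(inner ℝ (r.φ u i)
        (((h (Upsilon (r.X u) Ξ₀) i).1 : E3) - ((h (r.Ξ u) i).1 : E3)) •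
          ((h (Upsilon (r.X u) Ξ₀) i).1 : E3))) (Ici 0) u := by
    intro u hu
    have h1 := hasDerivWithinAt_rot_inv (Q := fun u => ((r.X u).2 i).1)
      (hasDerivWithinAt_matrix_entry ((hasDerivWithinAt_ambient (r.X_deriv u hu)).2 i).1)
      (hasDerivWithinAt_const u (Ici 0) ((h Ξ₀ i).1 : E3))
    have h2 : HasDerivWithinAt (fun u => ((h (Upsilon (r.X u) Ξ₀) i).1 : E3))
        (r.φ u i - inner ℝ (r.φ u i) ((h (Upsilon (r.X u) Ξ₀) i).1 : E3) •
          ((h (Upsilon (r.X u) Ξ₀) i).1 : E3)) (Ici 0) u := by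
      simp only [h_Upsilon] at h1 ⊢
      refine h1.congr_deriv ?_
      change -cross _ ((rho (r.X u) (h Ξ₀) i).1 : E3) + _ = _
      rw [cross_cross_left, inner_self_S2]
      simp [rot]
    refine (h2.sub (r.flow u hu i)).congr_deriv ?_
    rw [inner_sub_right, real_inner_comm ((h (r.Ξ u) i).1 : E3), r.inner_flow hu, sub_zero]
    abel
  have h1 := eq_zero_of_norm_deriv_le hw (r.continuousOn_flow i).norm (fun u hu => by
    rw [norm_neg, norm_smul, norm_S2, mul_one]
    exact norm_inner_le_norm _ _) (by rw [r.X_init, sub_self]) ht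
  exact Subtype.ext (sub_eq_zero.1 h1)

/-- In reciprocals the equation loses its nonlinearity: once the bearings agree, the lifted inverse
of the depth coordinate and the true range have the same derivative `-⟪y, V⟫`. -/
theorem h_snd_X {t : ℝ} (ht : 0 ≤ t) (i : Fin n) :
    (h (Upsilon (r.X t) Ξ₀) i).2 = (h (r.Ξ t) i).2 := by
  have hz : ((h Ξ₀ i).2 : ℝ) ≠ 0 := (h Ξ₀ i).2.2.ne'
  have ha : ∀ u, (((r.X u).2 i).2 : ℝ) ≠ 0 := fun u => ((r.X u).2 i).2.2.ne'
  have hd : ∀ u, 0 ≤ u → HasDerivWithinAt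
      (fun u => ((h (Upsilon (r.X u) Ξ₀) i).2 : ℝ)⁻¹ - r.range u i) 0 (Ici 0) u := by
    intro u hu
    have h1 : HasDerivWithinAt (fun u => (((r.X u).2 i).2 : ℝ)) _ (Ici 0) u :=
      ((hasDerivWithinAt_ambient (r.X_deriv u hu)).2 i).2
    have h2 := ((h1.mul_const ((h Ξ₀ i).2 : ℝ)).fun_inv (mul_ne_zero (ha u) hz)).sub
      (r.hasDerivWithinAt_range hu i)
    simp only [h_Upsilon]
    refine h2.congr_deriv ?_
    change -((((r.X u).2 i).2 : ℝ) * (((h (Upsilon (r.X u) Ξ₀) i).2 : ℝ) *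
      inner ℝ ((h (Upsilon (r.X u) Ξ₀) i).1 : E3) (r.U u).2) * ((h Ξ₀ i).2 : ℝ)) / _ - _ = _
    rw [r.h_fst_X hu, h_Upsilon]
    change -((((r.X u).2 i).2 : ℝ) *
      (((((r.X u).2 i).2 : ℝ) * ((h Ξ₀ i).2 : ℝ)) * _) * _) / _ - _ = _
    have := ha u
    field_simp
    ring
  have h1 := eq_of_hasDerivWithinAt_zero hd ht
  simp only [r.X_init, h_snd_eq, inv_inv, sub_self] at h1
  apply Subtype.ext
  rw [h_snd_eq, ← sub_eq_zero.1 h1, inv_inv]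

theorem Ξ_eq_Upsilon {t : ℝ} (ht : 0 ≤ t) : r.Ξ t = Upsilon (r.X t) Ξ₀ :=
  (Config.eq_of_pose_of_h (r.pose_X ht).symm
    (funext fun i => Prod.ext (r.h_fst_X ht i) (r.h_snd_X ht i))).symm

theorem e_eq_rho {t : ℝ} (ht : 0 ≤ t) :
    r.e t = rho (r.Xhat t * (r.X t)⁻¹)⁻¹ (h Ξ₀) := by
  rw [Run.e, r.Ξ_eq_Upsilon ht, h_Upsilon, mul_inv_rev, inv_inv, rho_mul]

/-! ### The dynamics of the output error -/

theorem e_fst (t : ℝ) (i : Fin n) :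
    ((r.e t i).1 : E3) = rot ((r.Xhat t).2 i).1 ((h (r.Ξ t) i).1 : E3) := by
  simp [Run.e, rho]

theorem e_snd (t : ℝ) (i : Fin n) :
    ((r.e t i).2 : ℝ) = (((r.Xhat t).2 i).2 : ℝ)⁻¹ * (r.range t i)⁻¹ := rfl

theorem hasDerivWithinAt_e_fst {t : ℝ} (ht : 0 ≤ t) (i : Fin n) :
    HasDerivWithinAt (fun u => ((r.e u i).1 : E3))
      (kQ i • cross (cross (r.e t i).1 (h Ξ₀ i).1) (r.e t i).1) (Ici 0) t := by
  have h1 := hasDerivWithinAt_rot (Q := fun u => ((r.Xhat u).2 i).1)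
    (hasDerivWithinAt_matrix_entry ((hasDerivWithinAt_ambient (r.Xhat_deriv t ht)).2 i).1)
    (r.flow t ht i)
  simp only [e_fst]
  refine h1.congr_deriv ?_
  -- The observer is driven by the lift at `Υ(X, Ξ₀)`; only after identifying this with the true
  -- configuration does its term cancel the flow.
  rw [← r.Ξ_eq_Upsilon ht]
  change WithLp.toLp 2 (((((r.Xhat t).2 i).1 : Matrix (Fin 3) (Fin 3) ℝ) *
      skew (cross (r.φ t i) (h (r.Ξ t) i).1) -
      -(kQ i • skew (cross (r.e t i).1 (h Ξ₀ i).1)) *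
        (((r.Xhat t).2 i).1 : Matrix (Fin 3) (Fin 3) ℝ)) *ᵥ ((h (r.Ξ t) i).1 : E3).ofLp) + _ = _
  rw [Matrix.sub_mulVec, ← Matrix.mulVec_mulVec, ← Matrix.mulVec_mulVec, Matrix.neg_mulVec,
    Matrix.smul_mulVec, sub_neg_eq_add, skew_mulVec, WithLp.toLp_add, WithLp.toLp_smul]
  change rot _ _ + kQ i • WithLp.toLp 2 (_ *ᵥ (rot _ ((h (r.Ξ t) i).1 : E3)).ofLp) + _ = _
  rw [toLp_skew_mulVec, cross_cross_left, inner_self_S2, real_inner_comm, r.inner_flow ht, e_fst,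
    zero_smul, one_smul, zero_sub, rot_neg]
  abel

/-- With `e_z = (â r)⁻¹` the velocity terms cancel, and the division by `e_z` in the innovation
makes the remaining equation linear. -/
theorem hasDerivWithinAt_e_snd {t : ℝ} (ht : 0 ≤ t) (i : Fin n) :
    HasDerivWithinAt (fun u => ((r.e u i).2 : ℝ) - ((h Ξ₀ i).2 : ℝ))
      (-ka i * (((r.e t i).2 : ℝ) - ((h Ξ₀ i).2 : ℝ))) (Ici 0) t := by
  have h1 : HasDerivWithinAt (fun u => (((r.Xhat u).2 i).2 : ℝ)) _ (Ici 0) t :=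
    ((hasDerivWithinAt_ambient (r.Xhat_deriv t ht)).2 i).2
  have ha : (((r.Xhat t).2 i).2 : ℝ) ≠ 0 := ((r.Xhat t).2 i).2.2.ne'
  have hr := (r.range_pos t i).ne'
  have h2 := ((h1.fun_inv ha).mul ((r.hasDerivWithinAt_range ht i).fun_inv hr)).sub_const
    ((h Ξ₀ i).2 : ℝ)
  refine h2.congr_deriv ?_
  rw [← r.Ξ_eq_Upsilon ht]
  change -((((r.Xhat t).2 i).2 : ℝ) * ((r.range t i)⁻¹ * inner ℝ ((h (r.Ξ t) i).1 : E3) (r.U t).2) -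
    -(ka i * ((((r.e t i).2 : ℝ) - ((h Ξ₀ i).2 : ℝ)) / ((r.e t i).2 : ℝ))) *
      (((r.Xhat t).2 i).2 : ℝ)) / _ * _ + _ = _
  rw [e_snd]
  field_simp
  ring

end Run

/-! ### The basin of attraction -/

/-- Surface measure is computed from the volume of the cone over the set; the cone over a point lies
in a line, a proper subspace of 3-space. -/
theorem toSphere_singleton (y : S2) :
    (MeasureTheory.volume : MeasureTheory.Measure E3).toSphere {y} = 0 := by
  rw [MeasureTheory.Measure.toSphere_apply' _ (measurableSet_singleton y)]
  refine mul_eq_zero_of_right _ ?_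
  refine MeasureTheory.measure_mono_null (t := (Submodule.span ℝ {(y : E3)} : Set E3)) ?_
    (MeasureTheory.Measure.addHaar_submodule _ _ ?_)
  · rintro _ ⟨c, -, _, ⟨_, rfl, rfl⟩, rfl⟩
    exact Submodule.smul_mem _ c (Submodule.mem_span_singleton_self _)
  · intro htop
    have h1 := finrank_span_singleton (K := ℝ) (v := (y : E3)) (ne_zero_of_mem_unit_sphere y)
    rw [htop, finrank_top] at h1
    simp at h1

theorem outputMeasure_fst_eq {n : ℕ} (i : Fin n) (y : S2) :
    outputMeasure n {e | (e i).1 = y} = 0 := by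
  have hemb : MeasurableEmbedding (Subtype.val : PosReal → ℝ) :=
    MeasurableEmbedding.subtype_coe measurableSet_Ioi
  have hsf : MeasureTheory.SigmaFinite
      ((MeasureTheory.volume : MeasureTheory.Measure ℝ).comap (Subtype.val : PosReal → ℝ)) := by
    refine MeasureTheory.SigmaFinite.of_map _ hemb.measurable.aemeasurable ?_
    rw [hemb.map_comap]
    infer_instance
  let μ : MeasureTheory.Measure (S2 × PosReal) :=
    ((MeasureTheory.volume : MeasureTheory.Measure E3).toSphere).prod
      ((MeasureTheory.volume : MeasureTheory.Measure ℝ).comap (Subtype.val : PosReal → ℝ))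
  have hμ : MeasureTheory.SigmaFinite μ := MeasureTheory.Measure.prod.instSigmaFinite
  have h1 : μ ({y} ×ˢ univ) = 0 := by
    rw [MeasureTheory.Measure.prod_prod, toSphere_singleton, zero_mul]
  have h2 := MeasureTheory.Measure.pi_eval_preimage_null (fun _ : Fin n => μ) (i := i) h1
  refine MeasureTheory.measure_mono_null (fun e he => ?_) h2
  exact ⟨he, mem_univ _⟩

/-- The outputs none of whose bearings is antipodal to that of the reference output. -/
def nonAntipodal {n : ℕ} (b : Output n) : Set (Output n) :=
  {e | ∀ i, (e i).1 ≠ -(b i).1}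

theorem isOpen_nonAntipodal {n : ℕ} (b : Output n) : IsOpen (nonAntipodal b) := by
  simp only [nonAntipodal, ofPred_forall]
  exact isOpen_iInter_of_finite fun i =>
    isOpen_ne_fun ((continuous_apply i).fst) continuous_const

theorem outputMeasure_compl_nonAntipodal {n : ℕ} (b : Output n) :
    outputMeasure n (nonAntipodal b)ᶜ = 0 := by
  refine MeasureTheory.measure_mono_null (t := ⋃ i, {e | (e i).1 = -(b i).1}) ?_
    (MeasureTheory.measure_iUnion_null fun i => outputMeasure_fst_eq i _)
  intro e he
  simpa [nonAntipodal] using he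

theorem Output.dist_lt_iff {n : ℕ} {a b : Output n} {ε : ℝ} (hε : 0 < ε) :
    dist a b < ε ↔
      ∀ i, ‖((a i).1 : E3) - (b i).1‖ < ε ∧ |((a i).2 : ℝ) - ((b i).2 : ℝ)| < ε := by
  rw [dist_pi_lt_iff hε]
  simp only [Prod.dist_eq, max_lt_iff, Subtype.dist_eq, dist_eq_norm, Real.norm_eq_abs]

theorem Output.dist_le_iff {n : ℕ} {a b : Output n} {ε : ℝ} (hε : 0 ≤ ε) :
    dist a b ≤ ε ↔
      ∀ i, ‖((a i).1 : E3) - (b i).1‖ ≤ ε ∧ |((a i).2 : ℝ) - ((b i).2 : ℝ)| ≤ ε := by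
  rw [dist_pi_le_iff hε]
  simp only [Prod.dist_eq, max_le_iff, Subtype.dist_eq, dist_eq_norm, Real.norm_eq_abs]

theorem Output.tendsto_dist_zero {n : ℕ} {a b : ℝ → Output n}
    (h1 : ∀ i, Tendsto (fun t => ‖((a t i).1 : E3) - (b t i).1‖) atTop (𝓝 0))
    (h2 : ∀ i, Tendsto (fun t => |((a t i).2 : ℝ) - ((b t i).2 : ℝ)|) atTop (𝓝 0)) :
    Tendsto (fun t => dist (a t) (b t)) atTop (𝓝 0) := by
  rw [Metric.tendsto_nhds]
  intro ε hε
  have h3 : ∀ᶠ t in atTop, ∀ i,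
      ‖((a t i).1 : E3) - (b t i).1‖ < ε ∧ |((a t i).2 : ℝ) - ((b t i).2 : ℝ)| < ε :=
    eventually_all.2 fun i =>
      ((h1 i).eventually_lt_const hε).and ((h2 i).eventually_lt_const hε)
  filter_upwards [h3] with t ht
  rw [Real.dist_0_eq_abs, abs_of_nonneg dist_nonneg]
  exact (Output.dist_lt_iff hε).2 ht

theorem tendsto_exp_neg_mul_mul {k : ℝ} (hk : 0 < k) (c : ℝ) :
    Tendsto (fun t => Real.exp (-k * t) * c) atTop (𝓝 0) := by
  have h1 : Tendsto (fun t : ℝ => -k * t) atTop atBot :=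
    tendsto_id.const_mul_atTop_of_neg (neg_lt_zero.2 hk)
  simpa using (Real.tendsto_exp_atBot.comp h1).mul_const c

namespace Run

variable {n : ℕ} {kQ ka : Fin n → ℝ} {kA : ℝ} {Ξ₀ : Config n} (r : Run n kQ ka kA Ξ₀)

theorem e_fst_decay (hkQ : ∀ i, 0 < kQ i) {t : ℝ} (ht : 0 ≤ t) (i : Fin n) :
    ‖((r.e t i).1 : E3) - (h Ξ₀ i).1‖ ≤
      Real.exp (-(kQ i * (1 + inner ℝ ((r.e 0 i).1 : E3) ((h Ξ₀ i).1 : E3)) / 2) * t) *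
        ‖((r.e 0 i).1 : E3) - (h Ξ₀ i).1‖ :=
  sphereFlow_norm_le (hkQ i).le (fun _ hu => r.hasDerivWithinAt_e_fst hu i) ht

theorem e_snd_decay {t : ℝ} (ht : 0 ≤ t) (i : Fin n) :
    |((r.e t i).2 : ℝ) - ((h Ξ₀ i).2 : ℝ)| ≤
      Real.exp (-ka i * t) * |((r.e 0 i).2 : ℝ) - ((h Ξ₀ i).2 : ℝ)| :=
  abs_le_exp_mul_of_deriv_eq (fun _ hu => r.hasDerivWithinAt_e_snd hu i) ht

theorem dist_e_le (hkQ : ∀ i, 0 < kQ i) (hka : ∀ i, 0 < ka i) {t : ℝ} (ht : 0 ≤ t) :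
    dist (r.e t) (h Ξ₀) ≤ dist (r.e 0) (h Ξ₀) := by
  refine (Output.dist_le_iff dist_nonneg).2 fun i => ?_
  have h0 := (Output.dist_le_iff dist_nonneg).1 (le_refl (dist (r.e 0) (h Ξ₀))) i
  have hc := (abs_le.1 (abs_inner_S2_le_one (r.e 0 i).1 (h Ξ₀ i).1)).1
  constructor
  · refine ((r.e_fst_decay hkQ ht i).trans (mul_le_of_le_one_left (norm_nonneg _) ?_)).trans h0.1
    rw [Real.exp_le_one_iff]
    have := hkQ i
    have : 0 ≤ kQ i * (1 + inner ℝ ((r.e 0 i).1 : E3) ((h Ξ₀ i).1 : E3)) / 2 * t := by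
      have : 0 ≤ 1 + inner ℝ ((r.e 0 i).1 : E3) ((h Ξ₀ i).1 : E3) := by linarith
      positivity
    linarith
  · refine ((r.e_snd_decay ht i).trans (mul_le_of_le_one_left (abs_nonneg _) ?_)).trans h0.2
    rw [Real.exp_le_one_iff]
    have := mul_nonneg (hka i).le ht
    linarith

/-! ### Errors of the estimates in terms of the output error -/

theorem h_Ξhat (t : ℝ) : h (r.Ξhat t) = rho (r.Xhat t) (h Ξ₀) := h_Upsilon _ _

theorem h_Ξ_eq_rho (t : ℝ) : h (r.Ξ t) = rho (r.Xhat t) (r.e t) := by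
  rw [Run.e, ← rho_mul, inv_mul_cancel]
  funext i
  refine Prod.ext (Subtype.ext ?_) ?_
  · simp [rho, rot_one]
  · simp [rho]

/-- Both bearings are the rotation `Q̂ᵀ` applied to the reference and error bearings, and rotations
are isometries. -/
theorem norm_bearing_sub (t : ℝ) (i : Fin n) :
    ‖((h (r.Ξhat t) i).1 : E3) - (h (r.Ξ t) i).1‖ = ‖((r.e t i).1 : E3) - (h Ξ₀ i).1‖ := by
  rw [h_Ξhat, h_Ξ_eq_rho, norm_sub_rev]
  change ‖rot _ _ - rot _ _‖ = _
  rw [← rot_sub, norm_rot]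

theorem Ξhat_depth_eq (t : ℝ) (i : Fin n) :
    ((h (r.Ξhat t) i).2 : ℝ) =
      ((h (r.Ξ t) i).2 : ℝ) * (((h Ξ₀ i).2 : ℝ) / ((r.e t i).2 : ℝ)) := by
  have he : ((r.e t i).2 : ℝ) ≠ 0 := (r.e t i).2.2.ne'
  rw [h_Ξhat, h_Ξ_eq_rho]
  change (((r.Xhat t).2 i).2 : ℝ) * ((h Ξ₀ i).2 : ℝ) =
    (((r.Xhat t).2 i).2 : ℝ) * ((r.e t i).2 : ℝ) * _
  field_simp

theorem abs_depth_sub (t : ℝ) (i : Fin n) :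
    |((h (r.Ξhat t) i).2 : ℝ) - ((h (r.Ξ t) i).2 : ℝ)| =
      |((r.e t i).2 : ℝ) - ((h Ξ₀ i).2 : ℝ)| / ((r.e t i).2 : ℝ) * ((h (r.Ξ t) i).2 : ℝ) := by
  have he : (0 : ℝ) < ((r.e t i).2 : ℝ) := (r.e t i).2.2
  have hz : (0 : ℝ) < ((h (r.Ξ t) i).2 : ℝ) := (h (r.Ξ t) i).2.2
  have h1 : ((h (r.Ξ t) i).2 : ℝ) * (((h Ξ₀ i).2 : ℝ) / ((r.e t i).2 : ℝ)) -
      ((h (r.Ξ t) i).2 : ℝ) = (((h Ξ₀ i).2 : ℝ) - ((r.e t i).2 : ℝ)) / ((r.e t i).2 : ℝ) *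
        ((h (r.Ξ t) i).2 : ℝ) := by
    field_simp
  rw [Ξhat_depth_eq, h1, abs_mul, abs_div, abs_of_pos he, abs_of_pos hz, abs_sub_comm]

/-- The gauge transformation that aligns the estimated pose with the true pose. -/
def gauge (t : ℝ) : SE3 := (r.Ξ t).pose * (r.Ξhat t).pose⁻¹

theorem gauge_mul_pose (t : ℝ) : r.gauge t * (r.Ξhat t).pose = (r.Ξ t).pose :=
  inv_mul_cancel_right _ _

/-- After alignment both points are images under the same rigid motion of the body-frame vectors `r
(e_z / z₀) ŷ` and `r y`. Splitting `(e_z / z₀) ŷ - y` into a radial part and `ŷ - y` gives the two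
terms. -/
theorem dist_gauge_act_le (t : ℝ) (i : Fin n) :
    dist ((r.gauge t).act ((r.Ξhat t).pt i)) ((r.Ξ t).pt i) ≤
      (|((r.e t i).2 : ℝ) - ((h Ξ₀ i).2 : ℝ)| / ((h Ξ₀ i).2 : ℝ) +
        ‖((r.e t i).1 : E3) - (h Ξ₀ i).1‖) * r.range t i := by
  have he : (0 : ℝ) < ((r.e t i).2 : ℝ) := (r.e t i).2.2
  have hz : (0 : ℝ) < ((h Ξ₀ i).2 : ℝ) := (h Ξ₀ i).2.2
  have hr := r.range_pos t i
  rw [← pose_act_h (r.Ξhat t), ← SE3.act_mul, gauge_mul_pose, ← pose_act_h (r.Ξ t),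
    ← norm_bearing_sub, Ξhat_depth_eq, h_snd_eq]
  simp only [SE3.act]
  rw [dist_add_right, dist_rot, mul_inv, inv_inv, inv_div, mul_smul, dist_smul₀,
    Real.norm_of_nonneg hr.le, mul_comm (r.range t i), dist_eq_norm]
  refine mul_le_mul_of_nonneg_right ?_ hr.le
  set y : E3 := ((h (r.Ξ t) i).1 : E3)
  set w : S2 := (h (r.Ξhat t) i).1
  have h1 : (((r.e t i).2 : ℝ) / ((h Ξ₀ i).2 : ℝ)) • (w : E3) - y =
      ((((r.e t i).2 : ℝ) - ((h Ξ₀ i).2 : ℝ)) / ((h Ξ₀ i).2 : ℝ)) • (w : E3) + ((w : E3) - y) := by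
    rw [sub_div, div_self hz.ne', sub_smul, one_smul]
    abel
  rw [h1]
  refine (norm_add_le _ _).trans (add_le_add_left (le_of_eq ?_) _)
  rw [norm_smul, norm_S2, mul_one, norm_div, Real.norm_eq_abs, Real.norm_of_nonneg hz.le]

/-! ### Convergence -/

theorem tendsto_e_fst (hkQ : ∀ i, 0 < kQ i) (hB : r.e 0 ∈ nonAntipodal (h Ξ₀)) (i : Fin n) :
    Tendsto (fun t => ‖((r.e t i).1 : E3) - (h Ξ₀ i).1‖) atTop (𝓝 0) := by
  have hc : -1 < inner ℝ ((r.e 0 i).1 : E3) ((h Ξ₀ i).1 : E3) :=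
    neg_one_lt_inner_S2 fun hy => hB i (Subtype.ext hy)
  have hk : 0 < kQ i * (1 + inner ℝ ((r.e 0 i).1 : E3) ((h Ξ₀ i).1 : E3)) / 2 :=
    div_pos (mul_pos (hkQ i) (by linarith)) two_pos
  refine tendsto_of_tendsto_of_tendsto_of_le_of_le' tendsto_const_nhds

    (tendsto_exp_neg_mul_mul hk ‖((r.e 0 i).1 : E3) - (h Ξ₀ i).1‖) (Eventually.of_forall fun _ => norm_nonneg _) ?_
  filter_upwards [eventually_ge_atTop 0] with t ht
  exact r.e_fst_decay hkQ ht i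

theorem tendsto_e_snd (hka : ∀ i, 0 < ka i) (i : Fin n) :
    Tendsto (fun t => |((r.e t i).2 : ℝ) - ((h Ξ₀ i).2 : ℝ)|) atTop (𝓝 0) := by
  refine tendsto_of_tendsto_of_tendsto_of_le_of_le' tendsto_const_nhds

    (tendsto_exp_neg_mul_mul (hka i) |((r.e 0 i).2 : ℝ) - ((h Ξ₀ i).2 : ℝ)|) (Eventually.of_forall fun _ => abs_nonneg _) ?_
  filter_upwards [eventually_ge_atTop 0] with t ht
  exact r.e_snd_decay ht i

theorem tendsto_e (hkQ : ∀ i, 0 < kQ i) (hka : ∀ i, 0 < ka i)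
    (hB : r.e 0 ∈ nonAntipodal (h Ξ₀)) : Tendsto r.e atTop (𝓝 (h Ξ₀)) :=
  tendsto_iff_dist_tendsto_zero.2
    (Output.tendsto_dist_zero (b := fun _ => h Ξ₀) (r.tendsto_e_fst hkQ hB) (r.tendsto_e_snd hka))

theorem exists_depth_le (i : Fin n) : ∃ Z : ℝ, ∀ t, 0 ≤ t → ((h (r.Ξ t) i).2 : ℝ) ≤ Z := by
  obtain ⟨K, hK⟩ := r.bounded.subset_closedBall (h (r.Ξ 0))
  refine ⟨K + ((h (r.Ξ 0) i).2 : ℝ), fun t ht => ?_⟩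
  have h1 := Metric.mem_closedBall.1 (hK (mem_image_of_mem _ (mem_Ici.2 ht)))
  have h2 := ((Output.dist_le_iff (dist_nonneg.trans h1)).1 h1 i).2
  linarith [(abs_le.1 h2).2]

theorem tendsto_dist_h (hkQ : ∀ i, 0 < kQ i) (hka : ∀ i, 0 < ka i)
    (hB : r.e 0 ∈ nonAntipodal (h Ξ₀)) :
    Tendsto (fun t => dist (h (r.Ξhat t)) (h (r.Ξ t))) atTop (𝓝 0) := by
  refine Output.tendsto_dist_zero (fun i => ?_) fun i => ?_
  · simp only [norm_bearing_sub]
    exact r.tendsto_e_fst hkQ hB i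
  -- The error formula controls the depth only relative to `z`; boundedness of the outputs makes
  -- this absolute.
  · obtain ⟨Z, hZ⟩ := r.exists_depth_le i
    have hz : ((h Ξ₀ i).2 : ℝ) ≠ 0 := (h Ξ₀ i).2.2.ne'
    have h1 : Tendsto (fun t => ((r.e t i).2 : ℝ)) atTop (𝓝 ((h Ξ₀ i).2 : ℝ)) :=
      tendsto_iff_dist_tendsto_zero.2 (r.tendsto_e_snd hka i)
    have h2 := ((r.tendsto_e_snd hka i).div h1 hz).mul_const Z
    rw [zero_div, zero_mul] at h2
    simp only [abs_depth_sub]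
    refine tendsto_of_tendsto_of_tendsto_of_le_of_le' tendsto_const_nhds h2
      (Eventually.of_forall fun t => ?_) ?_
    · exact mul_nonneg (div_nonneg (abs_nonneg _) (r.e t i).2.2.le) (h (r.Ξ t) i).2.2.le
    · filter_upwards [eventually_ge_atTop 0] with t ht
      exact mul_le_mul_of_nonneg_left (hZ t ht)
        (div_nonneg (abs_nonneg _) (r.e t i).2.2.le)

theorem tendsto_dist_gauge_act_div_range (hkQ : ∀ i, 0 < kQ i) (hka : ∀ i, 0 < ka i)
    (hB : r.e 0 ∈ nonAntipodal (h Ξ₀)) (i : Fin n) :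
    Tendsto (fun t => dist ((r.gauge t).act ((r.Ξhat t).pt i)) ((r.Ξ t).pt i) / r.range t i)
      atTop (𝓝 0) := by
  have h1 := ((r.tendsto_e_snd hka i).div_const ((h Ξ₀ i).2 : ℝ)).add (r.tendsto_e_fst hkQ hB i)
  rw [zero_div, zero_add] at h1
  refine tendsto_of_tendsto_of_tendsto_of_le_of_le tendsto_const_nhds h1
    (fun t => div_nonneg dist_nonneg (r.range_pos t i).le) fun t => ?_
  exact (div_le_iff₀ (r.range_pos t i)).2 (r.dist_gauge_act_le t i)

theorem tendsto_dist_gauge_act (hkQ : ∀ i, 0 < kQ i) (hka : ∀ i, 0 < ka i)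
    (hB : r.e 0 ∈ nonAntipodal (h Ξ₀)) {D : ℝ} (hD : ∀ t ≥ 0, ∀ i, r.range t i ≤ D) (i : Fin n) :
    Tendsto (fun t => dist ((r.gauge t).act ((r.Ξhat t).pt i)) ((r.Ξ t).pt i))
      atTop (𝓝 0) := by
  have h1 := (r.tendsto_dist_gauge_act_div_range hkQ hka hB i).mul_const D
  rw [zero_mul] at h1
  refine tendsto_of_tendsto_of_tendsto_of_le_of_le' tendsto_const_nhds h1
    (Eventually.of_forall fun _ => dist_nonneg) ?_
  filter_upwards [eventually_ge_atTop 0] with t ht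
  have hr := r.range_pos t i
  calc _ = dist ((r.gauge t).act ((r.Ξhat t).pt i)) ((r.Ξ t).pt i) / r.range t i * r.range t i :=
        (div_mul_cancel₀ _ hr.ne').symm
    _ ≤ _ := mul_le_mul_of_nonneg_left (hD t ht i) (div_nonneg dist_nonneg hr.le)

theorem e_exp_decay {κ : ℝ} (hκ : 0 < κ) (hκQ : ∀ i, κ ≤ kQ i) (hκa : ∀ i, κ ≤ ka i)
    (h1 : dist (r.e 0) (h Ξ₀) < 1) {t : ℝ} (ht : 0 ≤ t) :
    dist (r.e t) (h Ξ₀) ≤ Real.exp (-(κ / 2) * t) * dist (r.e 0) (h Ξ₀) := by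
  refine (Output.dist_le_iff (by positivity)).2 fun i => ?_
  have h0 := (Output.dist_le_iff dist_nonneg).1 (le_refl (dist (r.e 0) (h Ξ₀))) i
  constructor
  · refine (r.e_fst_decay (fun i => hκ.trans_le (hκQ i)) ht i).trans
      (mul_le_mul (Real.exp_le_exp.2 ?_) h0.1 (norm_nonneg _) (Real.exp_pos _).le)
    refine mul_le_mul_of_nonneg_right (neg_le_neg ?_) ht
    -- An initial distance below `1` forces `⟪e_y, b⟫ ≥ 0`, so the rate `k (1 + ⟪e_y, b⟫) / 2` is at
    -- least `κ / 2`.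
    have h2 := norm_sub_sq_S2 (r.e 0 i).1 (h Ξ₀ i).1
    have h3 : ‖((r.e 0 i).1 : E3) - (h Ξ₀ i).1‖ ^ 2 ≤ 1 :=
      pow_le_one₀ (norm_nonneg _) (h0.1.trans h1.le)
    have hc : 0 ≤ inner ℝ ((r.e 0 i).1 : E3) ((h Ξ₀ i).1 : E3) := by linarith
    have := mul_nonneg (hκ.le.trans (hκQ i)) hc
    linarith [hκQ i]
  · refine (r.e_snd_decay ht i).trans
      (mul_le_mul (Real.exp_le_exp.2 ?_) h0.2 (abs_nonneg _) (Real.exp_pos _).le)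
    refine mul_le_mul_of_nonneg_right (neg_le_neg ?_) ht
    linarith [hκa i]

end Run

theorem exists_pos_forall_le {n : ℕ} {f : Fin n → ℝ} (hf : ∀ i, 0 < f i) :
    ∃ m > (0 : ℝ), ∀ i, m ≤ f i := by
  rcases isEmpty_or_nonempty (Fin n) with hn | hn
  · exact ⟨1, one_pos, fun i => hn.elim i⟩
  · obtain ⟨j, hj⟩ := Finite.exists_min f
    exact ⟨f j, hf j, hj⟩

end VSLAM

end

/-! ### Choice of the basin and of the constants -/

theorem theorem1 (n : ℕ) (kQ ka : Fin n → ℝ) (kA : ℝ)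
    (hkQ : ∀ i, 0 < kQ i) (hka : ∀ i, 0 < ka i) (hkA : 0 < kA) (Ξ₀ : VSLAM.Config n) :
    ∃ B : Set (VSLAM.Output n), IsOpen B ∧ VSLAM.outputMeasure n Bᶜ = 0 ∧
      ∃ δ > (0 : ℝ), ∃ C > (0 : ℝ), ∃ α > (0 : ℝ),
        -- stability of the output error, uniformly in all trajectories
        (∀ ε > (0 : ℝ), ∃ η > (0 : ℝ), ∀ r : VSLAM.Run n kQ ka kA Ξ₀,
          dist (r.e 0) (VSLAM.h Ξ₀) < η → ∀ t ≥ 0, dist (r.e t) (VSLAM.h Ξ₀) < ε) ∧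
        ∀ r : VSLAM.Run n kQ ka kA Ξ₀,
          -- the lifted trajectory projects to the true trajectory
          (∀ t ≥ 0, r.Ξ t = VSLAM.Upsilon (r.X t) Ξ₀) ∧
          (∀ t ≥ 0, r.e t = VSLAM.rho (r.Xhat t * (r.X t)⁻¹)⁻¹ (VSLAM.h Ξ₀)) ∧
          -- the gauge transformation that aligns the estimated pose with the true pose
          ∃ S : ℝ → VSLAM.SE3, (∀ t ≥ 0, S t * (r.Ξhat t).pose = (r.Ξ t).pose) ∧
            -- almost global convergence
            (r.e 0 ∈ B →
              Filter.Tendsto r.e Filter.atTop (nhds (VSLAM.h Ξ₀)) ∧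
              Filter.Tendsto (fun t => dist (VSLAM.h (r.Ξhat t)) (VSLAM.h (r.Ξ t)))
                Filter.atTop (nhds 0) ∧
              (∀ i, Filter.Tendsto
                (fun t => dist ((S t).act ((r.Ξhat t).pt i)) ((r.Ξ t).pt i) / r.range t i)
                Filter.atTop (nhds 0)) ∧
              ((∃ D : ℝ, ∀ t ≥ 0, ∀ i, r.range t i ≤ D) → ∀ i, Filter.Tendsto
                (fun t => dist ((S t).act ((r.Ξhat t).pt i)) ((r.Ξ t).pt i))
                Filter.atTop (nhds 0))) ∧
            -- local exponential convergence
            (dist (r.e 0) (VSLAM.h Ξ₀) < δ → ∀ t ≥ 0,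
              dist (r.e t) (VSLAM.h Ξ₀)
                ≤ C * Real.exp (-α * t) * dist (r.e 0) (VSLAM.h Ξ₀) ∧
              ∀ i,
                dist (VSLAM.h (r.Ξhat t) i).1 (VSLAM.h (r.Ξ t) i).1
                  ≤ C * Real.exp (-α * t) * dist (r.e 0) (VSLAM.h Ξ₀) ∧
                dist (VSLAM.h (r.Ξhat t) i).2 (VSLAM.h (r.Ξ t) i).2
                  ≤ C * Real.exp (-α * t) * dist (r.e 0) (VSLAM.h Ξ₀)
                    * (VSLAM.h (r.Ξ t) i).2 ∧
                dist ((S t).act ((r.Ξhat t).pt i)) ((r.Ξ t).pt i)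
                  ≤ C * Real.exp (-α * t) * dist (r.e 0) (VSLAM.h Ξ₀) * r.range t i) := by
  obtain ⟨κ₁, hκ₁, hκQ⟩ := VSLAM.exists_pos_forall_le hkQ
  obtain ⟨κ₂, hκ₂, hκa⟩ := VSLAM.exists_pos_forall_le hka
  obtain ⟨m, hm, hmz⟩ := VSLAM.exists_pos_forall_le
    (f := fun i => ((VSLAM.h Ξ₀ i).2 : ℝ)) fun i => (VSLAM.h Ξ₀ i).2.2
  have hκ : 0 < min κ₁ κ₂ := lt_min hκ₁ hκ₂
  -- The bound `1` in `δ` gives the uniform bearing rate, and `m / 2` keeps `e_z` at least `m / 2`,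
  -- whence the `2 / m` in `C`. Since the distance never exceeds its initial value, `η = ε` suffices
  -- for stability.
  refine ⟨VSLAM.nonAntipodal (VSLAM.h Ξ₀), VSLAM.isOpen_nonAntipodal _,
    VSLAM.outputMeasure_compl_nonAntipodal _, min 1 (m / 2), lt_min one_pos (half_pos hm),
    1 + 2 / m, by positivity, min κ₁ κ₂ / 2, half_pos hκ,
    fun ε hε => ⟨ε, hε, fun r hr t ht => (r.dist_e_le hkQ hka ht).trans_lt hr⟩,
    fun r => ⟨fun t ht => r.Ξ_eq_Upsilon ht, fun t ht => r.e_eq_rho ht, r.gauge,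
      fun t _ => r.gauge_mul_pose t,
      fun hB => ⟨r.tendsto_e hkQ hka hB, r.tendsto_dist_h hkQ hka hB,
        r.tendsto_dist_gauge_act_div_range hkQ hka hB,
        fun ⟨D, hD⟩ => r.tendsto_dist_gauge_act hkQ hka hB hD⟩,
      fun hδ t ht => ?_⟩⟩
  have hexp := r.e_exp_decay hκ (fun i => (min_le_left _ _).trans (hκQ i))
    (fun i => (min_le_right _ _).trans (hκa i)) (hδ.trans_le (min_le_left _ _)) ht
  set b := Real.exp (-(min κ₁ κ₂ / 2) * t) * dist (r.e 0) (VSLAM.h Ξ₀) with hb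
  have hb0 : 0 ≤ b := dist_nonneg.trans hexp
  have hb' : b ≤ (1 + 2 / m) * Real.exp (-(min κ₁ κ₂ / 2) * t) * dist (r.e 0) (VSLAM.h Ξ₀) := by
    rw [mul_assoc, ← hb]
    exact le_mul_of_one_le_left hb0 (le_add_of_nonneg_right (by positivity))
  refine ⟨hexp.trans hb', fun i => ?_⟩
  have hcomp := (VSLAM.Output.dist_le_iff hb0).1 hexp i
  have hmi := hmz i
  have hdm : |((r.e t i).2 : ℝ) - ((VSLAM.h Ξ₀ i).2 : ℝ)| ≤ m / 2 :=
    (((VSLAM.Output.dist_le_iff dist_nonneg).1 le_rfl i).2.trans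
      (r.dist_e_le hkQ hka ht)).trans (hδ.le.trans (min_le_right _ _))
  have hem : m / 2 ≤ ((r.e t i).2 : ℝ) := by linarith [(abs_le.1 hdm).1]
  rw [mul_assoc (1 + 2 / m), ← hb] at hb' ⊢
  refine ⟨?_, ?_, ?_⟩
  · rw [Subtype.dist_eq, dist_eq_norm, r.norm_bearing_sub]
    exact hcomp.1.trans hb'
  · rw [Subtype.dist_eq, Real.dist_eq, r.abs_depth_sub]
    refine mul_le_mul_of_nonneg_right ?_ (VSLAM.h (r.Ξ t) i).2.2.le
    calc _ ≤ b / (m / 2) := div_le_div₀ hb0 hcomp.2 (half_pos hm) hem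
      _ = 2 / m * b := by field_simp
      _ ≤ (1 + 2 / m) * b := mul_le_mul_of_nonneg_right (by linarith) hb0
  · refine (r.dist_gauge_act_le t i).trans
      (mul_le_mul_of_nonneg_right ?_ (r.range_pos t i).le)
    calc _ ≤ b / m + b := add_le_add (div_le_div₀ hb0 hcomp.2 hm hmi) hcomp.1
      _ = (1 + 1 / m) * b := by field_simp; ring
      _ ≤ (1 + 2 / m) * b := by gcongr; norm_num
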